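/- Let $\Gamma$ be a finitely presented group, let $S$ be a finite generating set of $\Gamma$, and let $(\Gamma_n)_{n\in\mathbb N}$ be a sequence of subgroups of finite index in $\Gamma$. For a subgroup $H\le\Gamma$ whose normalizer has finite index, let $\mu_H$ be the uniform probability measure on the (finite) set of $\Gamma$-conjugates of $H$; it is a Borel probability measure on the space $\mathrm{Sub}_\Gamma$ of subgroups of $\Gamma$ with the Chabauty topology (the topology inherited from $\{0,1\}^\Gamma$). Assume that $(\Gamma_n)$ is \emph{Farber}, that is, $\mu_{\Gamma_n}\to\mu_{\{1\}}$ weakly. Let $G_n=\mathrm{Sch}(\Gamma,\Gamma_n,S)$ be the Schreier graph, regarded as a simple graph: its vertices are the right cosets of $\Gamma_n$ in $\Gamma$, and $x$ is joined to $xs$ for every $s\in S$ with $xs\neq x$. For two graphs $G,G'$ on the same vertex set, with path metrics $d_G,d_{G'}$ (infinite between different components), put $$d_L(G,G')=\max\Big\{\max_{(x,y)\in E(G)}d_{G'}(x,y),\ \max_{(x,y)\in E(G')}d_G(x,y)\Big\}.$$ Assume that $(G_n)$ has \emph{subexponential distortion}: there are positive integers $d_r$ and real numbers $\varepsilon_r$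 $(r\in\mathbb N)$ with $\varepsilon_r\to0$ and $\varepsilon_r\ln d_r\to0$ as $r\to\infty$, and for every $r$ there are graphs $G_n^{(r)}$ on the vertex sets $V(G_n)$ such that $d_L(G_n,G_n^{(r)})\le d_r$ for all $n$ and $$\limsup_{n\to\infty}\frac{|E(G_n^{(r)})|}{|V(G_n)|}<1+\varepsilon_r .$$ Then, writing $\mathrm{trs}(H)$ for the size of the torsion subgroup of the abelianization of $H$, every $\mathrm{trs}(\Gamma_n)$ is finite, and the homology torsion growth of $\Gamma$ with respect to $(\Gamma_n)$ exists and vanishes: $$\mathrm{Trs}(\Gamma,(\Gamma_n))=\lim_{n\to\infty}\frac{\ln\mathrm{trs}(\Gamma_n)}{|\Gamma:\Gamma_n|}=0 .$$ -/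

import Mathlib

open Filter Topology MeasureTheory

noncomputable section

namespace TorsionGrowth

/-! ### Invariant random subgroups and Farber sequences -/

/-- The Chabauty topology of a discrete group: the topology that the set of all subgroups of
`Γ` inherits from the product space `{0,1}^Γ` when a subgroup is identified with its indicator function. -/
instance (Γ : Type*) [Group Γ] : TopologicalSpace (Subgroup Γ) :=
  open Classical in
  TopologicalSpace.induced (fun (H : Subgroup Γ) (g : Γ) => decide (g ∈ H))
    (inferInstance : TopologicalSpace (Γ → Bool))

instance (Γ : Type*) [Group Γ] : MeasurableSpace (Subgroup Γ) := borel _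

instance (Γ : Type*) [Group Γ] : BorelSpace (Subgroup Γ) := ⟨rfl⟩

instance (Γ : Type*) [Group Γ] : T2Space (Subgroup Γ) := by
  classical
  refine Topology.IsEmbedding.t2Space (Y := Γ → Bool)
    (f := fun (H : Subgroup Γ) (g : Γ) => decide (g ∈ H)) ⟨⟨?_⟩, ?_⟩
  · change TopologicalSpace.induced _ _ = _
    congr!
  · intro H K h
    refine Subgroup.ext fun g => ?_
    simpa using congrFun h g

variable {Γ : Type*} [Group Γ]

/-- The conjugacy class of `H` in `Γ`. -/
def conjugates (H : Subgroup Γ) : Set (Subgroup Γ) :=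
  Set.range fun g : Γ => H.map (MulAut.conj g).toMonoidHom

theorem conjugates_nonempty (H : Subgroup Γ) : (conjugates H).Nonempty :=
  Set.range_nonempty _

theorem conjugates_finite (H : Subgroup Γ) [hH : (Subgroup.normalizer (H : Set Γ)).FiniteIndex] :
    (conjugates H).Finite := by
  have : Finite (Γ ⧸ Subgroup.normalizer (H : Set Γ)) := Subgroup.finite_quotient_of_finiteIndex
  refine (Set.finite_range fun q : Γ ⧸ Subgroup.normalizer (H : Set Γ) =>
    H.map (MulAut.conj q.out).toMonoidHom).subset ?_
  rintro _ ⟨g, rfl⟩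
  refine ⟨(g : Γ ⧸ Subgroup.normalizer (H : Set Γ)), ?_⟩
  obtain ⟨n, hn⟩ := QuotientGroup.mk_out_eq_mul (Subgroup.normalizer (H : Set Γ)) g
  refine Subgroup.ext fun x => ?_
  have key := Subgroup.mem_normalizer_iff''.1 n.2 (g⁻¹ * x * g)
  rw [Subgroup.mem_map_equiv, Subgroup.mem_map_equiv, hn]
  simpa only [MulAut.conj_symm_apply, mul_inv_rev, mul_assoc] using key.symm

instance (H : Subgroup Γ) [H.FiniteIndex] : (Subgroup.normalizer (H : Set Γ)).FiniteIndex :=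
  Subgroup.finiteIndex_of_le Subgroup.le_normalizer

instance (H : Subgroup Γ) [H.Normal] : (Subgroup.normalizer (H : Set Γ)).FiniteIndex := by
  rw [Subgroup.normalizer_eq_top]
  infer_instance

/-- `μ_H`: the law of a uniform random conjugate of `H`, for a subgroup `H` whose normalizer has
finite index in `Γ`. -/
def uniformConjugate (H : Subgroup Γ) [(Subgroup.normalizer (H : Set Γ)).FiniteIndex] :
    ProbabilityMeasure (Subgroup Γ) :=
  ⟨ProbabilityTheory.uniformOn (conjugates H),
    ProbabilityTheory.isProbabilityMeasure_uniformOn (conjugates_finite H) (conjugates_nonempty H)⟩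

/-- A sequence of finite index subgroups is Farber if `μ_{Γ_n}` converges weakly to `μ_1`. -/
def IsFarber (H : ℕ → Subgroup Γ) [∀ n, (H n).FiniteIndex] : Prop :=
  Tendsto (fun n => uniformConjugate (H n)) atTop (𝓝 (uniformConjugate (⊥ : Subgroup Γ)))

/-! ### Schreier graphs and distortion -/

/-- The space of right cosets `H g`. -/
abbrev RightCosets (H : Subgroup Γ) : Type _ := Quotient (QuotientGroup.rightRel H)

instance (H : Subgroup Γ) [H.FiniteIndex] : Finite (RightCosets H) :=
  have : Finite (Γ ⧸ H) := Subgroup.finite_quotient_of_finiteIndex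
  Finite.of_equiv _ (QuotientGroup.quotientRightRelEquivQuotientLeftRel H).symm

/-- The Schreier graph of `Γ` with respect to `H` and `S`, as a simple graph (labels, orientations,
loops and multiplicities forgotten): the vertices are the right cosets, and `x` is joined to `x s`
for all `s ∈ S`. -/
def schreierGraph (H : Subgroup Γ) (S : Finset Γ) : SimpleGraph (RightCosets H) :=
  SimpleGraph.fromRel fun x y =>
    ∃ g : Γ, ∃ s ∈ S, x = Quotient.mk _ g ∧ y = Quotient.mk _ (g * s)

/-- The bi-Lipschitz distance of two graphs on the same vertex set; it is `⊤` if some edge of one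
graph joins two vertices in different components of the other. -/
def bilipDist {V : Type*} (G G' : SimpleGraph V) : ℕ∞ :=
  max (⨆ (x : V) (y : V) (_ : G.Adj x y), G'.edist x y)
    (⨆ (x : V) (y : V) (_ : G'.Adj x y), G.edist x y)

/-- `|E(G)| / |V(G)|` for a finite graph. -/
def edgeDensity {V : Type*} [Finite V] (G : SimpleGraph V) : ℝ :=
  (G.edgeSet.ncard : ℝ) / (Nat.card V : ℝ)

/-- Subexponential distortion of a sequence of finite graphs `G n`. For each `r`, the graphs
`G' r n` are on the same vertex sets; as `d r` does not depend on `n`, they form a rewiring. -/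
def HasSubexponentialDistortion {V : ℕ → Type*} [∀ n, Finite (V n)]
    (G : ∀ n, SimpleGraph (V n)) : Prop :=
  ∃ (d : ℕ → ℕ) (ε : ℕ → ℝ) (G' : ℕ → ∀ n, SimpleGraph (V n)),
    (∀ r, 0 < d r) ∧
    Tendsto ε atTop (𝓝 0) ∧
    Tendsto (fun r => ε r * Real.log (d r)) atTop (𝓝 0) ∧
    ∀ r, (∀ n, bilipDist (G n) (G' r n) ≤ (d r : ℕ∞)) ∧
      limsup (fun n => ((edgeDensity (G' r n) : ℝ) : EReal)) atTop < ((1 + ε r : ℝ) : EReal)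

/-! ### Homology torsion -/

/-- The size of the torsion subgroup of the abelianization. -/
def trs (H : Type*) [Group H] : ℕ := Nat.card (CommGroup.torsion (Abelianization H))

end TorsionGrowth

end

/-! For `H` of finite index, `H^ab` is controlled by few generators and short relations.
Reidemeister-Schreier rewriting gives a cocycle `c` on `Γ ⧸ H` with values in `H^ab` that restricts
to the quotient map `H → H^ab` at the base coset; a coboundary vanishing there does not affect this.

Let `G` be a graph at bi-Lipschitz distance at most `d` from the Schreier graph. A potential along a
spanning tree of `G` kills the cocycle on the tree, which leaves `|E(G)| - |V| + 1` edge values. An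
edge from `v` to `s • v` is replaced by a `G`-path of length at most `d`, and this path is realized
by some `g` in the ball of radius `d²` with `g • v = s • v`. If no nontrivial element of the ball of
radius `d² + 1` fixes `v`, then `g = s`, so `c s v` is a sum of at most `d` signed edge values. At
the remaining, thin points the values of the Schreier edges are added as generators
(`exists_coboundary_small`).

Relators of a finite presentation of `Γ` then become integer vectors of `ℓ¹`-norm at most `C d`, and
`H^ab` embeds in the lattice quotient by them. A determinant bound gives `trs H ≤ (C d) ^ m`, where
`m` is the number of generators (`exists_submodule_card_quotient_le`, `trs_le_pow`,
`exists_trs_le_pow`). The Farber property makes the thin part `o(index)`, so `ln trs / index ≤ ε_r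
ln (C d_r) + o(1)` for each fixed `r`; then `r` is taken large. -/

/-! ### Torsion of lattice quotients by short vectors. -/

theorem Matrix.natAbs_det_le_prod_sum {J : Type*} [Fintype J] [DecidableEq J]
    (M : Matrix J J ℤ) : M.det.natAbs ≤ ∏ i, ∑ j, (M i j).natAbs := by
  rw [← Matrix.det_transpose, Matrix.det_apply, Finset.prod_univ_sum]
  refine (Int.natAbs_sum_le _ _).trans ?_
  have h : ∀ σ : Equiv.Perm J, (Equiv.Perm.sign σ • ∏ i, M.transpose (σ i) i).natAbs =
      ∏ i, (M i (σ i)).natAbs := by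
    intro σ
    rw [Units.smul_def, smul_eq_mul, Int.natAbs_mul, Int.units_natAbs, one_mul]
    exact map_prod Int.natAbsHom _ _
  simp only [h]
  -- The expanded product of row sums runs over all maps `J → J`; the Leibniz terms are those of the
  -- permutations.
  rw [← Finset.sum_image (s := Finset.univ) (g := fun σ : Equiv.Perm J => (σ : J → J))
    (f := fun p => ∏ i, (M i (p i)).natAbs) (fun _ _ _ _ h => DFunLike.coe_injective h)]
  exact Finset.sum_le_sum_of_subset (fun p _ => by simp)

/-- A lattice quotient that bounds the torsion of `ℤ^J / span R`, for a set `R` of vectors of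
`ℓ¹`-norm at most `L`. -/
theorem exists_submodule_card_quotient_le {J : Type*} [Fintype J] (R : Set (J → ℤ)) (L : ℕ)
    (hL : 1 ≤ L) (hR : ∀ r ∈ R, ∑ j, (r j).natAbs ≤ L) :
    ∃ N : Submodule ℤ (J → ℤ), Finite ((J → ℤ) ⧸ N) ∧
      Nat.card ((J → ℤ) ⧸ N) ≤ L ^ Fintype.card J ∧
      ∀ x ∈ N, ∀ n : ℤ, n ≠ 0 → n • x ∈ Submodule.span ℤ R → x ∈ Submodule.span ℤ R := by
  classical
  let v : (J → ℤ) →ₗ[ℤ] (J → ℚ) := (Int.castAddHom ℚ).toIntLinearMap.compLeft J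
  have hv : ∀ x j, v x j = (x j : ℚ) := fun _ _ => rfl
  -- `s` is a maximal `ℚ`-independent subset of `R`. Unit vectors complete it to a basis `b`, whose
  -- integer span is `N`; the index of `N` is a determinant with rows of norm at most `L`.
  obtain ⟨s, hsR, -, hsspan, hs⟩ := exists_linearIndepOn_extension (K := ℚ) (v := v)
    (linearIndepOn_empty ℚ v) (Set.empty_subset R)
  let E : Set (J → ℤ) := Set.range fun j => Pi.single j 1
  obtain ⟨b, hbE, hsb, hbspan, hb⟩ := exists_linearIndepOn_extension (K := ℚ) (v := v)
    hs (hsR.trans (Set.subset_union_left (t := E)))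
  have htop : (⊤ : Submodule ℚ (J → ℚ)) ≤ Submodule.span ℚ (Set.range fun x : b => v x) := by
    rw [← (Pi.basisFun ℚ J).span_eq, Submodule.span_le]
    rintro _ ⟨j, rfl⟩
    have h := hbspan ⟨Pi.single j 1, Or.inr ⟨j, rfl⟩, rfl⟩
    rw [Set.image_eq_range] at h
    convert! h using 1
    ext k
    rw [hv, Pi.basisFun_apply]
    by_cases hjk : k = j
    · subst hjk; simp
    · simp [hjk]
  let B : Module.Basis b ℚ (J → ℚ) := Module.Basis.mk hb htop
  have hB : ∀ x : b, B x = v x := fun x => Module.Basis.mk_apply hb htop x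
  let e : J ≃ b := (Pi.basisFun ℚ J).indexEquiv B
  have hnorm : ∀ x ∈ b, ∑ j, (x j).natAbs ≤ L := by
    intro x hx
    rcases hbE hx with h | ⟨j, rfl⟩
    · exact hR x h
    · refine le_trans (le_of_eq ?_) hL
      rw [Finset.sum_eq_single j] <;> simp +contextual
  let w : J → J → ℤ := fun j => (e j : J → ℤ)
  have hw : LinearIndependent ℤ w := by
    have h1 : LinearIndependent ℤ fun j => v (w j) :=
      (hb.restrict_scalars' ℤ).comp e e.injective
    exact h1.of_comp v
  let N := Submodule.span ℤ (Set.range w)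
  let bN : Module.Basis J ℤ N := Module.Basis.span hw
  have hcard := Submodule.natAbs_det_basis_change (Pi.basisFun ℤ J) N bN
  have hdet : (Pi.basisFun ℤ J).det ((↑) ∘ bN) = (Matrix.of w).det := by
    rw [Pi.basisFun_det_apply]
    congr 1
    ext i j
    exact congrFun (congrArg Subtype.val (Module.Basis.span_apply hw i)) j
  rw [hdet] at hcard
  have hne : (Matrix.of w).det ≠ 0 := by
    intro h0
    obtain ⟨c, hc, hc0⟩ := Matrix.exists_vecMul_eq_zero_iff.2 h0
    refine hc (funext (Fintype.linearIndependent_iff.1 hw c ?_))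
    rw [← hc0, Matrix.vecMul_eq_sum]
    rfl
  refine ⟨N, ?_, ?_, ?_⟩
  · refine Nat.finite_of_card_ne_zero ?_
    rw [← hcard]
    exact Int.natAbs_ne_zero.2 hne
  · rw [← hcard]
    refine (Matrix.natAbs_det_le_prod_sum _).trans ?_
    refine (Finset.prod_le_pow_card _ _ L fun j _ => hnorm _ (e j).2).trans ?_
    simp
  · intro x hx n hn hnx
    have hvx : v x ∈ Submodule.span ℚ (v '' s) := by
      have h1 : v (n • x) ∈ Submodule.span ℚ (v '' R) := by
        have := Submodule.mem_map_of_mem (f := v) hnx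
        rw [Submodule.map_span] at this
        exact Submodule.span_subset_span ℤ ℚ _ this
      have h2 : (n : ℚ) • v x ∈ Submodule.span ℚ (v '' s) := by
        have := Submodule.span_le.2 hsspan h1
        rwa [map_smul, ← Int.cast_smul_eq_zsmul ℚ] at this
      exact (Submodule.smul_mem_iff _ (by exact_mod_cast hn)).1 h2
    obtain ⟨c, rfl⟩ := (Submodule.mem_span_range_iff_exists_fun ℤ).1 hx
    have hc : ∀ j, (e j : J → ℤ) ∉ s → c j = 0 := by
      intro j hj
      have h3 : v '' s = B '' {x : b | (x : J → ℤ) ∈ s} := by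
        ext y
        constructor
        · rintro ⟨x, hx, rfl⟩
          exact ⟨⟨x, hsb hx⟩, hx, hB _⟩
        · rintro ⟨x, hx, rfl⟩
          exact ⟨x, hx, (hB _).symm⟩
      rw [h3, B.mem_span_image] at hvx
      have h4 : B.repr (v (∑ j, c j • w j)) (e j) = c j := by
        have : v (∑ j, c j • w j) = ∑ j, (c j : ℚ) • B (e j) := by
          rw [map_sum]
          refine Finset.sum_congr rfl fun j _ => ?_
          rw [map_smul, hB, Int.cast_smul_eq_zsmul]
        rw [this, map_sum, Finsupp.finsetSum_apply, Finset.sum_eq_single j]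
        · simp
        · intro k _ hk
          simp [hk]
        · simp
      by_contra hcj
      refine hj (hvx (a := e j) ?_)
      rw [Finset.mem_coe, Finsupp.mem_support_iff, h4]
      exact Int.cast_ne_zero.2 hcj
    refine Submodule.sum_mem _ fun j _ => ?_
    by_cases hj : (e j : J → ℤ) ∈ s
    · exact Submodule.smul_mem _ _ (Submodule.subset_span (hsR hj))
    · simp [hc j hj]

noncomputable section

namespace TorsionGrowth

/-! ### Cocycles and `ℓ¹`-balls. -/

/-- A cocycle of a group action with values in an abelian group. -/
def IsCocycle {Γ V A : Type*} [Group Γ] [MulAction Γ V] [AddCommGroup A] (c : Γ → V → A) : Prop :=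
  ∀ g h v, c (g * h) v = c g (h • v) + c h v

namespace IsCocycle

variable {Γ V A : Type*} [Group Γ] [MulAction Γ V] [AddCommGroup A] {c : Γ → V → A}

theorem map_one (hc : IsCocycle c) (v : V) : c 1 v = 0 := by
  have h := hc 1 1 v
  rwa [mul_one, one_smul, left_eq_add] at h

theorem map_inv (hc : IsCocycle c) (g : Γ) (v : V) : c g⁻¹ v = -c g (g⁻¹ • v) := by
  have h := hc g g⁻¹ v
  rw [mul_inv_cancel, hc.map_one] at h
  exact (neg_eq_of_add_eq_zero_right h.symm).symm

theorem map_inv_smul (hc : IsCocycle c) (g : Γ) (v : V) : c g⁻¹ (g • v) = -c g v := by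
  rw [hc.map_inv, inv_smul_smul]

/-- Adding a coboundary to a cocycle. -/
theorem add_coboundary (hc : IsCocycle c) (b : V → A) :
    IsCocycle fun g v => c g v + b (g • v) - b v := by
  intro g h v
  simp only [hc g h v, mul_smul]
  abel

end IsCocycle

/-- The integer combinations of a family `a` whose coefficients have `ℓ¹`-norm at most `D`. -/
def l1Ball {J A : Type*} [Fintype J] [AddCommGroup A] (a : J → A) (D : ℕ) : Set A :=
  {x | ∃ c : J → ℤ, ∑ j, (c j).natAbs ≤ D ∧ ∑ j, c j • a j = x}

section l1Ball

variable {J A : Type*} [Fintype J] [AddCommGroup A] {a : J → A} {D E : ℕ} {x y : A}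

theorem zero_mem_l1Ball : (0 : A) ∈ l1Ball a D := ⟨0, by simp, by simp⟩

theorem l1Ball_mono (h : D ≤ E) : l1Ball a D ⊆ l1Ball a E :=
  fun _ ⟨c, hc, hx⟩ => ⟨c, hc.trans h, hx⟩

theorem add_mem_l1Ball (hx : x ∈ l1Ball a D) (hy : y ∈ l1Ball a E) :
    x + y ∈ l1Ball a (D + E) := by
  obtain ⟨c, hc, rfl⟩ := hx
  obtain ⟨e, he, rfl⟩ := hy
  refine ⟨c + e, ?_, ?_⟩
  · refine le_trans (Finset.sum_le_sum fun j _ => Int.natAbs_add_le (c j) (e j)) ?_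
    rw [Finset.sum_add_distrib]
    exact add_le_add hc he
  · simp only [Pi.add_apply, add_smul, Finset.sum_add_distrib]

theorem neg_mem_l1Ball (hx : x ∈ l1Ball a D) : -x ∈ l1Ball a D := by
  obtain ⟨c, hc, rfl⟩ := hx
  exact ⟨-c, by simpa using hc, by simp⟩

theorem apply_mem_l1Ball (j : J) : a j ∈ l1Ball a 1 := by
  classical
  refine ⟨Pi.single j 1, ?_, ?_⟩
  · rw [Finset.sum_eq_single j] <;> simp +contextual
  · rw [Finset.sum_eq_single j] <;> simp +contextual

end l1Ball

section FreeCocycle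

variable {Γ V M X : Type*} [Group Γ] [MulAction Γ V] [AddCommGroup M]

/-- The skew action of a free group on `V × M` determined by `ρ`. -/
def skewAction (φ : FreeGroup X →* Γ) (ρ : X → V → M) : FreeGroup X →* Equiv.Perm (V × M) :=
  FreeGroup.lift fun x =>
    { toFun := fun p => (φ (.of x) • p.1, p.2 + ρ x p.1)
      invFun := fun p => ((φ (.of x))⁻¹ • p.1, p.2 - ρ x ((φ (.of x))⁻¹ • p.1))
      left_inv := fun p => by simp
      right_inv := fun p => by simp }

/-- The skew action commutes with translations of the fibre `M`, so it is determined by its values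
on the zero section; these form the cocycle. -/
theorem skewAction_apply (φ : FreeGroup X →* Γ) (ρ : X → V → M) (f : FreeGroup X) :
    ∀ v m, skewAction φ ρ f (v, m) = (φ f • v, m + (skewAction φ ρ f (v, 0)).2) := by
  induction f using FreeGroup.induction_on with
  | C1 => simp
  | of x => intro v m; simp [skewAction]
  | inv_of x _ => intro v m; simp [skewAction, sub_eq_add_neg]
  | mul f g hf hg =>
    intro v m
    rw [map_mul, Equiv.Perm.mul_apply, hg, hf, Equiv.Perm.mul_apply, hg v 0, hf _ (0 + _)]
    simp [mul_smul, add_assoc]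

/-- A cocycle of a free group can be prescribed on the generators. -/
theorem exists_free_cocycle (φ : FreeGroup X →* Γ) (ρ : X → V → M) :
    ∃ r : FreeGroup X → V → M, (∀ x v, r (.of x) v = ρ x v) ∧
      ∀ f g v, r (f * g) v = r f (φ g • v) + r g v := by
  refine ⟨fun f v => (skewAction φ ρ f (v, 0)).2, fun x v => by simp [skewAction], ?_⟩
  intro f g v
  simp only [map_mul, Equiv.Perm.mul_apply]
  rw [skewAction_apply φ ρ g, skewAction_apply φ ρ f]
  simp [add_comm]

theorem l1_free_cocycle_le {J : Type*} [Fintype J] {φ : FreeGroup X →* Γ}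
    {r : FreeGroup X → V → J → ℤ} (hr : ∀ f g v, r (f * g) v = r f (φ g • v) + r g v) {D : ℕ}
    (hD : ∀ x v, ∑ j, (r (.of x) v j).natAbs ≤ D) [DecidableEq X] (f : FreeGroup X) (v : V) :
    ∑ j, (r f v j).natAbs ≤ f.norm * D := by
  have h1 : ∀ v, r 1 v = 0 := fun v => by
    have h := hr 1 1 v
    rwa [mul_one, _root_.map_one, one_smul, left_eq_add] at h
  have hinv : ∀ f v, r f⁻¹ v = -r f ((φ f)⁻¹ • v) := fun f v => by
    have h := hr f f⁻¹ v
    rw [mul_inv_cancel, h1, _root_.map_inv] at h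
    exact (neg_eq_of_add_eq_zero_right h.symm).symm
  have key : ∀ (l : List (X × Bool)) (v : V), ∑ j, (r (FreeGroup.mk l) v j).natAbs ≤ l.length * D := by
    intro l
    induction l with
    | nil => intro v; rw [← FreeGroup.one_eq_mk, h1]; simp
    | cons p l ih =>
      intro v
      have hp : ∀ v, ∑ j, (r (FreeGroup.mk [p]) v j).natAbs ≤ D := by
        intro v
        obtain ⟨x, b | b⟩ := p
        · have : FreeGroup.mk [(x, false)] = (FreeGroup.of x)⁻¹ := rfl
          rw [this, hinv]
          simpa using hD x _
        · exact hD x v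
      have h2 : FreeGroup.mk (p :: l) = FreeGroup.mk [p] * FreeGroup.mk l := by
        rw [FreeGroup.mul_mk]; rfl
      rw [h2, hr, List.length_cons, add_mul, one_mul, add_comm (l.length * D)]
      refine le_trans (Finset.sum_le_sum fun j _ => Int.natAbs_add_le _ _) ?_
      rw [Finset.sum_add_distrib]
      exact add_le_add (hp _) (ih _)
  have h := key f.toWord v
  rwa [FreeGroup.mk_toWord] at h

end FreeCocycle

/-! ### From the cocycle of a subgroup to its homology torsion. -/

variable {Γ : Type*} [Group Γ]

/-- The values are the classes of the Schreier elements of the transversal `Quotient.out`. At the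
base coset the representative lies in `H`, so it only conjugates `h` inside `H`, which the
abelianization does not see. -/
theorem exists_cocycle (H : Subgroup Γ) :
    ∃ c : Γ → Γ ⧸ H → Additive (Abelianization H), IsCocycle c ∧
      ∀ h : H, c h ((1 : Γ) : Γ ⧸ H) = Additive.ofMul (Abelianization.of h) := by
  have hmem : ∀ (g : Γ) (v : Γ ⧸ H), (g • v).out⁻¹ * (g * v.out) ∈ H := by
    intro g v
    rw [← QuotientGroup.eq, QuotientGroup.out_eq']
    conv_lhs => rw [← QuotientGroup.out_eq' v]
    rfl
  let c : Γ → Γ ⧸ H → Additive (Abelianization H) := fun g v =>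
    Additive.ofMul (Abelianization.of ⟨_, hmem g v⟩)
  refine ⟨c, ?_, ?_⟩
  · intro g h v
    simp only [c, ← ofMul_mul, ← _root_.map_mul]
    congr 3
    simp only [mul_smul]
    group
  · intro h
    have h1 : ((1 : Γ) : Γ ⧸ H).out ∈ H := by
      have h := QuotientGroup.out_eq' ((1 : Γ) : Γ ⧸ H)
      rw [QuotientGroup.eq, mul_one] at h
      exact inv_mem_iff.1 h
    let t : H := ⟨_, h1⟩
    have h2 : (h : Γ) • ((1 : Γ) : Γ ⧸ H) = (1 : Γ) := by
      change (((h : Γ) * 1 : Γ) : Γ ⧸ H) = _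
      rw [QuotientGroup.eq]
      simp
    have h3 : (⟨_, hmem h ((1 : Γ) : Γ ⧸ H)⟩ : H) = t⁻¹ * (h * t) := by
      apply Subtype.ext
      simp [t, h2]
    simp only [c]
    congr 1
    rw [h3, _root_.map_mul, _root_.map_mul, _root_.map_inv, mul_comm, mul_assoc, mul_inv_cancel,
      mul_one]

/-- If the cocycle of `H` is small on the generators of a presentation of `Γ`, then the homology
torsion of `H` is small. -/
theorem trs_le_pow {X : Type*} [DecidableEq X] (φ : FreeGroup X →* Γ) (hφ : Function.Surjective φ)
    (R : Set (FreeGroup X)) (hR : Subgroup.normalClosure R = φ.ker) (k : ℕ)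
    (hk : ∀ f ∈ R, f.norm ≤ k) (H : Subgroup Γ) {J : Type*} [Fintype J]
    (a : J → Additive (Abelianization H)) (c : Γ → Γ ⧸ H → Additive (Abelianization H))
    (hc : IsCocycle c)
    (hc1 : ∀ h : H, c h ((1 : Γ) : Γ ⧸ H) = Additive.ofMul (Abelianization.of h)) (D : ℕ)
    (hD : ∀ x v, c (φ (.of x)) v ∈ l1Ball a D) (hkD : 1 ≤ k * D) :
    Finite (CommGroup.torsion (Abelianization H)) ∧ trs H ≤ (k * D) ^ Fintype.card J := by
  -- Short coefficient vectors are chosen on the generators only. The resulting lift of `c` to `J →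
  -- ℤ` is a cocycle of the free group, and its failure to descend to `Γ` is measured by the
  -- relators.
  choose ρ hρD hρ using hD
  obtain ⟨r, hrρ, hr⟩ := exists_free_cocycle φ ρ
  have hr1 : ∀ v, r 1 v = 0 := fun v => by
    have h := hr 1 1 v
    rwa [mul_one, _root_.map_one, one_smul, left_eq_add] at h
  let ψ : (J → ℤ) →ₗ[ℤ] Additive (Abelianization H) := Fintype.linearCombination ℤ a
  have hψ : ∀ f v, ψ (r f v) = c (φ f) v := by
    intro f
    induction f using FreeGroup.induction_on with
    | C1 => intro v; rw [hr1, _root_.map_zero, _root_.map_one, hc.map_one]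
    | of x => intro v; rw [hrρ]; exact hρ x v
    | inv_of x ih =>
      intro v
      have h := hr (.of x) (.of x)⁻¹ v
      rw [mul_inv_cancel, hr1] at h
      rw [← neg_eq_of_add_eq_zero_right h.symm, map_neg, ih, _root_.map_inv, hc.map_inv]
    | mul f g hf hg => intro v; rw [hr, map_add, hf, hg, _root_.map_mul, hc]
  let R' : Set (J → ℤ) := {y | ∃ f ∈ R, ∃ v, y = r f v}
  let N := Submodule.span ℤ R'
  have hN : N ≤ LinearMap.ker ψ := by
    refine Submodule.span_le.2 ?_
    rintro _ ⟨f, hf, v, rfl⟩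
    have hf1 : φ f = 1 := by
      rw [← MonoidHom.mem_ker, ← hR]
      exact Subgroup.subset_normalClosure hf
    simp [hψ, hf1, hc.map_one]
  have hker : ∀ f ∈ φ.ker, ∀ v, r f v ∈ N := by
    let K : Subgroup (FreeGroup X) :=
      { carrier := {f | φ f = 1 ∧ ∀ v, r f v ∈ N}
        one_mem' := ⟨_root_.map_one φ, fun v => by rw [hr1]; exact N.zero_mem⟩
        mul_mem' := fun {f g} hf hg => ⟨by rw [_root_.map_mul, hf.1, hg.1, mul_one], fun v => by
          rw [hr]; exact N.add_mem (hf.2 _) (hg.2 _)⟩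
        inv_mem' := fun {f} hf => ⟨by rw [_root_.map_inv, hf.1, inv_one], fun v => by
          have h := hr f f⁻¹ v
          rw [mul_inv_cancel, hr1] at h
          rw [← neg_eq_of_add_eq_zero_right h.symm]
          exact N.neg_mem (hf.2 _)⟩ }
    -- As `f` acts trivially, the contributions of `g` and `g⁻¹` to the conjugate cancel.
    have : K.Normal := ⟨fun f hf g => ⟨by simp [hf.1], fun v => by
      have h := hr (g * f) g⁻¹ v
      have h' := hr g g⁻¹ v
      rw [mul_inv_cancel, hr1] at h'
      rw [h, hr g f, hf.1, one_smul, add_right_comm, ← h', zero_add]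
      exact hf.2 _⟩⟩
    have hle : φ.ker ≤ K := by
      rw [← hR]
      exact Subgroup.normalClosure_le_normal fun f hf =>
        ⟨by rw [← MonoidHom.mem_ker, ← hR]; exact Subgroup.subset_normalClosure hf,
          fun v => Submodule.subset_span ⟨f, hf, v, rfl⟩⟩
    exact fun f hf => (hle hf).2
  have hfix : ∀ h : H, (h : Γ) • ((1 : Γ) : Γ ⧸ H) = (1 : Γ) := by
    intro h
    change (((h : Γ) * 1 : Γ) : Γ ⧸ H) = _
    rw [QuotientGroup.eq]
    simp
  let l : H.comap φ →* Multiplicative ((J → ℤ) ⧸ N) :=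
    { toFun := fun f => Multiplicative.ofAdd (N.mkQ (r f ((1 : Γ) : Γ ⧸ H)))
      map_one' := by simp [hr1]
      map_mul' := fun f g => by
        rw [← ofAdd_add, ← map_add, Subgroup.coe_mul, hr, hfix ⟨φ g, g.2⟩] }
  have hsurj : Function.Surjective (φ.subgroupComap H) := fun h => by
    obtain ⟨f, hf⟩ := hφ h
    exact ⟨⟨f, by simp [hf]⟩, Subtype.ext hf⟩
  have hkerl : (φ.subgroupComap H).ker ≤ l.ker := by
    intro f hf
    rw [MonoidHom.mem_ker] at hf ⊢
    change Multiplicative.ofAdd (N.mkQ _) = 1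
    rw [ofAdd_eq_one, Submodule.mkQ_apply, Submodule.Quotient.mk_eq_zero]
    exact hker f (congrArg Subtype.val hf) _
  -- The lifted cocycle at the base coset descends to `H`; the map induced by `ψ` is a left inverse
  -- on `H^ab`, which makes `ι` injective.
  let ι₀ : H →* Multiplicative ((J → ℤ) ⧸ N) :=
    (φ.subgroupComap H).liftOfSurjective hsurj ⟨l, hkerl⟩
  let ι : Abelianization H →* Multiplicative ((J → ℤ) ⧸ N) := Abelianization.lift ι₀
  have hι : Function.Injective ι := by
    refine Function.LeftInverse.injective
      (g := fun q => Additive.toMul (N.liftQ ψ hN (Multiplicative.toAdd q))) fun x => ?_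
    obtain ⟨h, rfl⟩ := QuotientGroup.mk_surjective x
    obtain ⟨f, rfl⟩ := hsurj h
    change Additive.toMul (N.liftQ ψ hN (Multiplicative.toAdd
      (Abelianization.lift ι₀ (Abelianization.of (φ.subgroupComap H f))))) = _
    rw [Abelianization.lift_apply_of]
    have : ι₀ (φ.subgroupComap H f) = l f :=
      MonoidHom.liftOfRightInverse_comp_apply _ _ _ _ _
    rw [this]
    change Additive.toMul (N.liftQ ψ hN (N.mkQ _)) = _
    rw [Submodule.mkQ_apply, Submodule.liftQ_apply, hψ]
    exact congrArg Additive.toMul (hc1 (φ.subgroupComap H f))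
  obtain ⟨N₁, hfin, hcard, hN₁⟩ := exists_submodule_card_quotient_le R' (k * D) hkD (by
    rintro _ ⟨f, hf, v, rfl⟩
    refine (l1_free_cocycle_le hr (fun x v => ?_) f v).trans (Nat.mul_le_mul_right D (hk f hf))
    rw [hrρ]
    exact hρD x v)
  let lft : Abelianization H → J → ℤ := fun x => (Multiplicative.toAdd (ι x)).out
  have hlft : ∀ x, N.mkQ (lft x) = Multiplicative.toAdd (ι x) := fun x => Quotient.out_eq' _
  -- `lft` need not be additive, but the difference of two lifts of torsion elements is torsion
  -- modulo `N`, so it lies in `N` as soon as it lies in `N₁`.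
  have hinj : Function.Injective
      fun x : CommGroup.torsion (Abelianization H) => N₁.mkQ (lft x) := by
    intro x y hxy
    obtain ⟨m, hm, hmx⟩ := isOfFinOrder_iff_pow_eq_one.1 x.2
    obtain ⟨n, hn, hny⟩ := isOfFinOrder_iff_pow_eq_one.1 y.2
    have h1 : lft x - lft y ∈ N₁ := (Submodule.Quotient.eq N₁).1 hxy
    have h2 : ((m * n : ℕ) : ℤ) • (lft x - lft y) ∈ N := by
      rw [← Submodule.Quotient.mk_eq_zero, ← Submodule.mkQ_apply, map_smul, map_sub, hlft, hlft,
        natCast_zsmul, smul_sub, ← toAdd_pow, ← toAdd_pow, ← _root_.map_pow, ← _root_.map_pow,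
        pow_mul, hmx, mul_comm m, pow_mul, hny, one_pow, one_pow, sub_self]
    have h3 := hN₁ _ h1 _ (by positivity) h2
    refine Subtype.ext (hι ?_)
    change Multiplicative.toAdd (ι x) = Multiplicative.toAdd (ι y)
    rw [← hlft, ← hlft]
    exact (Submodule.Quotient.eq N).2 h3
  exact ⟨Finite.of_injective _ hinj, (Nat.card_le_card_of_injective _ hinj).trans hcard⟩

/-! ### Word balls and the growth of cocycles. -/

open scoped Pointwise

/-- The symmetric set `S ∪ S⁻¹ ∪ {1}`; its `n`-th power is the ball of radius `n` in the word
metric. -/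
def unitBall {Γ : Type*} [Group Γ] (S : Finset Γ) : Set Γ := insert 1 ((S : Set Γ) ∪ (S : Set Γ)⁻¹)

section unitBall

variable {S : Finset Γ}

theorem one_mem_unitBall : (1 : Γ) ∈ unitBall S := Set.mem_insert _ _

theorem mem_unitBall {s : Γ} (hs : s ∈ S) : s ∈ unitBall S := Or.inr (Or.inl hs)

theorem unitBall_inv : (unitBall S)⁻¹ = unitBall S := by
  ext x
  simp only [unitBall, Set.mem_inv, Set.mem_insert_iff, Set.mem_union, inv_inv, inv_eq_one]
  tauto

theorem unitBall_pow_finite (n : ℕ) : (unitBall S ^ n).Finite := by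
  induction n with
  | zero => simp
  | succ n ih =>
    rw [pow_succ]
    exact ih.mul ((S.finite_toSet.union S.finite_toSet.inv).insert 1)

theorem unitBall_pow_mono {m n : ℕ} (h : m ≤ n) : unitBall S ^ m ⊆ unitBall S ^ n :=
  Set.pow_subset_pow_right one_mem_unitBall h

theorem inv_mem_unitBall_pow {n : ℕ} {g : Γ} (h : g ∈ unitBall S ^ n) : g⁻¹ ∈ unitBall S ^ n := by
  rw [← Set.mem_inv, ← inv_pow, unitBall_inv]
  exact h

theorem mul_mem_unitBall_pow {m n : ℕ} {g h : Γ} (hg : g ∈ unitBall S ^ m)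
    (hh : h ∈ unitBall S ^ n) : g * h ∈ unitBall S ^ (m + n) := by
  rw [pow_add]
  exact Set.mul_mem_mul hg hh

theorem exists_mem_unitBall_pow (hS : Subgroup.closure (S : Set Γ) = ⊤) (g : Γ) :
    ∃ n, g ∈ unitBall S ^ n := by
  have hg : g ∈ Subgroup.closure (S : Set Γ) := hS ▸ Subgroup.mem_top g
  induction hg using Subgroup.closure_induction with
  | mem s hs => exact ⟨1, by rw [pow_one]; exact mem_unitBall hs⟩
  | one => exact ⟨0, by simp⟩
  | mul x y _ _ hx hy =>
    obtain ⟨m, hm⟩ := hx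
    obtain ⟨n, hn⟩ := hy
    exact ⟨m + n, mul_mem_unitBall_pow hm hn⟩
  | inv x _ hx =>
    obtain ⟨m, hm⟩ := hx
    exact ⟨m, inv_mem_unitBall_pow hm⟩

/-- A cocycle that is small on `S` grows linearly with the word length. -/
theorem IsCocycle.mem_l1Ball_of_mem_unitBall_pow {V A J : Type*} [MulAction Γ V] [AddCommGroup A]
    [Fintype J] {a : J → A} {c : Γ → V → A} (hc : IsCocycle c) {d : ℕ}
    (h : ∀ s ∈ S, ∀ v, c s v ∈ l1Ball a d) (n : ℕ) :
    ∀ g ∈ unitBall S ^ n, ∀ v, c g v ∈ l1Ball a (n * d) := by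
  induction n with
  | zero =>
    intro g hg v
    rw [pow_zero, Set.mem_one] at hg
    rw [hg, hc.map_one]
    exact zero_mem_l1Ball
  | succ n ih =>
    intro g hg v
    rw [pow_succ] at hg
    obtain ⟨x, hx, y, hy, rfl⟩ := hg
    simp only
    rw [hc, add_mul, one_mul]
    refine add_mem_l1Ball (ih x hx _) ?_
    rcases hy with rfl | hy | hy
    · rw [hc.map_one]; exact zero_mem_l1Ball
    · exact h y hy v
    · have h1 := neg_mem_l1Ball (h y⁻¹ hy (y • v))
      rwa [hc.map_inv_smul, neg_neg] at h1

end unitBall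

/-! ### Spanning trees and few generators for a cocycle. -/

/-- Serves to integrate a cocycle from the root of a tree outwards; the decreasing rank makes the
recursion well-founded. -/
theorem exists_rec_along_parent {V A : Type*} (rk : V → ℕ) (o : V) (p : V → V)
    (hp : ∀ v, v ≠ o → rk (p v) < rk v) (F : V → A → A) (x₀ : A) :
    ∃ b : V → A, b o = x₀ ∧ ∀ v, v ≠ o → b v = F v (b (p v)) := by
  classical
  let step : ∀ v, (∀ w, rk w < rk v → A) → A := fun v ih =>
    if h : v = o then x₀ else F v (ih (p v) (hp v h))
  let wf : WellFounded fun v w => rk v < rk w := (measure rk).wf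
  refine ⟨wf.fix step, ?_, fun v hv => ?_⟩
  · rw [wf.fix_eq]; simp [step]
  · rw [wf.fix_eq]; simp [step, hv]

theorem exists_parent {V : Type*} {G : SimpleGraph V} (hG : G.Preconnected) (o v : V)
    (hv : v ≠ o) : ∃ w, G.Adj w v ∧ G.dist w o < G.dist v o := by
  obtain ⟨q, hq⟩ := (hG v o).exists_walk_length_eq_dist
  cases q with
  | nil => exact absurd rfl hv
  | cons h q =>
    refine ⟨_, h.symm, ?_⟩
    rw [← hq, SimpleGraph.Walk.length_cons]
    exact Nat.lt_succ_of_le (SimpleGraph.dist_le q)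

/-- A cocycle on the vertices of a graph that is quasi-isometric to a Schreier graph is, up to
a coboundary, generated by few elements: the edges outside a spanning tree, and the edges of the
Schreier graph at the vertices where its injectivity radius is small. -/
theorem exists_coboundary_small {Γ V A : Type*} [Group Γ] [MulAction Γ V] [Finite V]
    [AddCommGroup A] {c : Γ → V → A} (hc : IsCocycle c) (o : V) (S : Finset Γ)
    (G : SimpleGraph V) (hG : G.Preconnected) (d : ℕ) (hd : 0 < d)
    (hGS : ∀ x y, G.Adj x y → ∃ g ∈ unitBall S ^ d, g • x = y)
    (hSG : ∀ s ∈ S, ∀ v, ∃ q : G.Walk v (s • v), q.length ≤ d) (B : Set V)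
    (hB : ∀ v, v ∉ B → ∀ g ∈ unitBall S ^ (d * d + 1), g • v = v → g = 1) :
    ∃ (b : V → A) (T : Finset A), b o = 0 ∧
      T.card + Nat.card V ≤ G.edgeSet.ncard + 1 + B.ncard * S.card ∧
      ∀ s ∈ S, ∀ v, c s v + b (s • v) - b v ∈ l1Ball (Subtype.val : T → A) d := by
  classical
  have := Fintype.ofFinite V
  choose w₀ hw₀U hw₀ using hGS
  let f : V ≃ Fin (Fintype.card V) := Fintype.equivFin V
  -- Edge labels must be inverse under reversal. An enumeration of `V` selects one orientation of
  -- each edge on which the label is chosen.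
  have hw : ∃ w : V → V → Γ, ∀ x y, G.Adj x y →
      w x y ∈ unitBall S ^ d ∧ w x y • x = y ∧ w y x = (w x y)⁻¹ := by
    refine ⟨fun x y => if h : G.Adj x y then
      (if f x < f y then w₀ x y h else (w₀ y x h.symm)⁻¹) else 1, fun x y h => ?_⟩
    simp only [dif_pos h, dif_pos h.symm]
    rcases lt_or_gt_of_ne (f.injective.ne h.ne) with hlt | hlt
    · simp only [if_pos hlt, if_neg hlt.not_gt]
      exact ⟨hw₀U x y h, hw₀ x y h, trivial⟩
    · simp only [if_pos hlt, if_neg hlt.not_gt, inv_inv]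
      refine ⟨inv_mem_unitBall_pow (hw₀U y x h.symm), ?_, trivial⟩
      rw [inv_smul_eq_iff, hw₀]
  obtain ⟨w, hw⟩ := hw
  have hp : ∃ p : V → V, ∀ v, v ≠ o → G.Adj (p v) v ∧ G.dist (p v) o < G.dist v o := by
    choose! p hp using exists_parent hG o
    exact ⟨p, hp⟩
  obtain ⟨p, hp⟩ := hp
  -- The potential `b` is the one for which the corrected cocycle `α` vanishes on every edge from a
  -- parent to its child.
  obtain ⟨b, hbo, hb⟩ := exists_rec_along_parent (fun v => G.dist v o) o p (fun v hv => (hp v hv).2)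
    (fun v x => x - c (w (p v) v) (p v)) (0 : A)
  let α : V → V → A := fun x y => c (w x y) x + b y - b x
  have hα : ∀ x y, G.Adj x y → α y x = -α x y := by
    intro x y h
    have h1 := hc.map_inv_smul (w x y) x
    rw [(hw x y h).2.1] at h1
    simp only [α]
    rw [(hw x y h).2.2, h1]
    abel
  have hαp : ∀ v, v ≠ o → α (p v) v = 0 := by
    intro v hv
    simp only [α]
    rw [hb v hv]
    abel
  let tree : Finset (Sym2 V) := (Finset.univ.erase o).image fun v => s(p v, v)
  have htree : tree.card = Fintype.card V - 1 := by
    rw [Finset.card_image_of_injOn, Finset.card_erase_of_mem (Finset.mem_univ o), Finset.card_univ]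
    intro v hv u hu h
    have hv' := hp v (Finset.ne_of_mem_erase hv)
    have hu' := hp u (Finset.ne_of_mem_erase hu)
    rcases Sym2.eq_iff.1 h with h | h
    · exact h.2
    -- Two vertices that are each other's parent would each be closer to the root than the other.
    · have h1 := hv'.2
      have h2 := hu'.2
      rw [h.1] at h1
      rw [← h.2] at h2
      exact absurd h1 h2.not_gt
  have htreeG : tree ⊆ G.edgeFinset := by
    intro e he
    obtain ⟨v, hv, rfl⟩ := Finset.mem_image.1 he
    rw [SimpleGraph.mem_edgeFinset]
    exact (hp v (Finset.ne_of_mem_erase hv)).1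
  let T₁ : Finset A := (G.edgeFinset \ tree).image fun e => α e.out.1 e.out.2
  let T₂ : Finset A := (B.toFinset ×ˢ S).image fun q => c q.2 q.1 + b (q.2 • q.1) - b q.1
  let T := T₁ ∪ T₂
  have hαT : ∀ x y, G.Adj x y → α x y ∈ l1Ball (Subtype.val : T → A) 1 := by
    intro x y h
    by_cases he : s(x, y) ∈ tree
    · obtain ⟨v, hv, hve⟩ := Finset.mem_image.1 he
      have hv := Finset.ne_of_mem_erase hv
      have h0 : α x y = 0 := by
        rcases Sym2.eq_iff.1 hve with ⟨rfl, rfl⟩ | ⟨rfl, rfl⟩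
        · exact hαp _ hv
        · rw [hα _ _ (hp _ hv).1, hαp _ hv, neg_zero]
      rw [h0]
      exact zero_mem_l1Ball
    · have hmem : α (s(x, y)).out.1 (s(x, y)).out.2 ∈ T :=
        Finset.mem_union_left _ (Finset.mem_image_of_mem _
          (Finset.mem_sdiff.2 ⟨SimpleGraph.mem_edgeFinset.2 h, he⟩))
      have h1 := apply_mem_l1Ball (a := (Subtype.val : T → A)) ⟨_, hmem⟩
      have h2 : s((s(x, y)).out.1, (s(x, y)).out.2) = s(x, y) := Quot.out_eq _
      -- The orientation stored in `T₁` may be the opposite one, which only changes a sign.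
      rcases Sym2.eq_iff.1 h2 with ⟨hx, hy⟩ | ⟨hx, hy⟩
      · simpa only [hx, hy] using h1
      · have h3 := neg_mem_l1Ball h1
        simp only [hx, hy] at h3
        rwa [← hα _ _ h.symm] at h3
  have hwalk : ∀ {x y} (q : G.Walk x y), ∃ g ∈ unitBall S ^ (d * q.length), g • x = y ∧
      c g x + b y - b x ∈ l1Ball (Subtype.val : T → A) q.length := by
    intro x y q
    induction q with
    | nil => exact ⟨1, by simp, by simp, by simpa [hc.map_one] using zero_mem_l1Ball⟩
    | @cons x z y h q ih =>
      obtain ⟨g, hgU, hg, hgc⟩ := ih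
      refine ⟨g * w x z, ?_, ?_, ?_⟩
      · rw [SimpleGraph.Walk.length_cons, mul_add, mul_one]
        exact mul_mem_unitBall_pow hgU (hw x z h).1
      · rw [mul_smul, (hw x z h).2.1, hg]
      · rw [hc, (hw x z h).2.1, SimpleGraph.Walk.length_cons]
        have h1 := add_mem_l1Ball hgc (hαT x z h)
        convert h1 using 1
        simp only [α]
        abel
  refine ⟨b, T, hbo, ?_, ?_⟩
  · have h1 : T.card ≤ (G.edgeFinset.card - tree.card) + B.toFinset.card * S.card := by
      refine (Finset.card_union_le _ _).trans (add_le_add ?_ ?_)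
      · exact Finset.card_image_le.trans (Finset.card_sdiff_of_subset htreeG).le
      · exact Finset.card_image_le.trans (Finset.card_product _ _).le
    have h2 := Finset.card_le_card htreeG
    have h3 : 0 < Fintype.card V := Fintype.card_pos_iff.2 ⟨o⟩
    rw [Nat.card_eq_fintype_card, Set.ncard_eq_toFinset_card', Set.ncard_eq_toFinset_card']
    change _ ≤ G.edgeFinset.card + 1 + _
    omega
  · intro s hs v
    by_cases hv : v ∈ B
    · refine l1Ball_mono hd (apply_mem_l1Ball (a := (Subtype.val : T → A)) ⟨_, ?_⟩)
      exact Finset.mem_union_right _ (Finset.mem_image.2 ⟨(v, s), by simp [hv, hs], rfl⟩)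
    · obtain ⟨q, hq⟩ := hSG s hs v
      obtain ⟨g, hgU, hg, hgc⟩ := hwalk q
      -- The path element `g` has length at most `d * d`, so `g⁻¹ * s` lies in the ball of radius `d
      -- * d + 1` and fixes `v`. Outside `B` this forces `g = s`.
      have h1 : g⁻¹ * s = 1 := by
        refine hB v hv _ ?_ ?_
        · refine mul_mem_unitBall_pow (inv_mem_unitBall_pow
            (unitBall_pow_mono (Nat.mul_le_mul_left d hq) hgU)) ?_
          rw [pow_one]
          exact mem_unitBall hs
        · rw [mul_smul, ← hg, inv_smul_smul]
      obtain rfl := inv_mul_eq_one.1 h1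
      exact l1Ball_mono hq hgc

/-! ### Consequences of the Farber property. -/

/-- A finite union of cylinder sets; its indicator is thus a continuous test function for weak
convergence. -/
theorem isClopen_setOf_exists_mem {F : Set Γ} (hF : F.Finite) :
    IsClopen {K : Subgroup Γ | ∃ g ∈ F, g ∈ K} := by
  classical
  have h : {K : Subgroup Γ | ∃ g ∈ F, g ∈ K} = ⋃ g ∈ F, {K : Subgroup Γ | g ∈ K} := by
    ext K; simp
  rw [h]
  refine hF.isClopen_biUnion fun g _ => ?_
  have h1 : Continuous fun K : Subgroup Γ => (decide (g ∈ K) : Bool) := by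
    have h2 : Continuous fun (K : Subgroup Γ) (g : Γ) => (decide (g ∈ K) : Bool) := by
      convert! continuous_induced_dom
    exact (continuous_apply g).comp h2
  convert! (isClopen_discrete ({true} : Set Bool)).preimage h1
  ext K
  simp

theorem conjugates_eq_range_stabilizer (H : Subgroup Γ) :
    conjugates H = Set.range fun v : Γ ⧸ H => MulAction.stabilizer Γ v := by
  have h : ∀ g : Γ, MulAction.stabilizer Γ (g : Γ ⧸ H) = H.map (MulAut.conj g).toMonoidHom := by
    intro g
    have h1 : (g : Γ ⧸ H) = g • ((1 : Γ) : Γ ⧸ H) := by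
      change _ = ((g * 1 : Γ) : Γ ⧸ H)
      rw [mul_one]
    rw [h1, MulAction.stabilizer_smul_eq_stabilizer_map_conj, MulAction.stabilizer_quotient]
  ext K
  constructor
  · rintro ⟨g, rfl⟩
    exact ⟨g, h g⟩
  · rintro ⟨v, rfl⟩
    obtain ⟨g, rfl⟩ := QuotientGroup.mk_surjective v
    exact ⟨g, (h g).symm⟩

theorem conjugates_bot : conjugates (⊥ : Subgroup Γ) = {⊥} := by
  simp [conjugates, Set.range_const]

/-- The stabilizer of a uniform random point of `Γ ⧸ H` is a uniform random conjugate of `H`. -/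
theorem uniformConjugate_real_mul_index (H : Subgroup Γ) [H.FiniteIndex] (E : Set (Subgroup Γ)) :
    (uniformConjugate H : Measure (Subgroup Γ)).real E * H.index =
      ({v : Γ ⧸ H | MulAction.stabilizer Γ v ∈ E}.ncard : ℝ) := by
  classical
  have := Fintype.ofFinite (Γ ⧸ H)
  let κ : Γ ⧸ H → Subgroup Γ := fun v => MulAction.stabilizer Γ v
  let C : Finset (Subgroup Γ) := Finset.univ.image κ
  have hC : conjugates H = C := by
    rw [conjugates_eq_range_stabilizer]
    simp [C, κ]
  let m := (Finset.univ.filter fun u => κ u = κ ((1 : Γ) : Γ ⧸ H)).card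
  -- By transitivity, translations carry the fibres of `κ` onto each other, so all have the same
  -- size `m`.
  have hm : ∀ K ∈ C, (Finset.univ.filter fun u => κ u = K).card = m := by
    intro K hK
    obtain ⟨v, -, rfl⟩ := Finset.mem_image.1 hK
    obtain ⟨g, hg⟩ := MulAction.exists_smul_eq Γ v ((1 : Γ) : Γ ⧸ H)
    refine Finset.card_bij (fun u _ => g • u) ?_ (fun _ _ _ _ h => smul_left_cancel g h) ?_
    · intro u hu
      have hu : κ u = κ v := by simpa using hu
      simp only [Finset.mem_filter, Finset.mem_univ, true_and, κ, ← hg,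
        MulAction.stabilizer_smul_eq_stabilizer_map_conj]
      exact congrArg _ hu
    · intro u hu
      have hu : κ u = κ (g • v) := by simpa [hg] using hu
      refine ⟨g⁻¹ • u, ?_, smul_inv_smul g u⟩
      have h1 : v = g⁻¹ • g • v := (inv_smul_smul g v).symm
      simp only [Finset.mem_filter, Finset.mem_univ, true_and]
      rw [h1]
      simp only [κ, MulAction.stabilizer_smul_eq_stabilizer_map_conj g⁻¹] at hu ⊢
      rw [hu]
  have hE : {v : Γ ⧸ H | κ v ∈ E}.ncard = (C.filter (· ∈ E)).card * m := by
    rw [Set.ncard_eq_toFinset_card', Finset.card_eq_sum_card_fiberwise (f := κ)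
      (t := C.filter (· ∈ E))]
    · rw [Finset.sum_const_nat]
      intro K hK
      rw [Finset.mem_filter] at hK
      rw [← hm K hK.1]
      congr 1
      ext v
      simp only [Finset.mem_filter, Set.mem_toFinset, Set.mem_ofPred_eq, Finset.mem_univ, true_and,
        and_iff_right_iff_imp]
      rintro rfl
      exact hK.2
    · intro v hv
      simp only [Finset.coe_filter, Set.mem_ofPred_eq]
      exact ⟨Finset.mem_image_of_mem _ (Finset.mem_univ v), by simpa using hv⟩
  have hV : H.index = C.card * m := by
    rw [Subgroup.index, Nat.card_eq_fintype_card, ← Finset.card_univ,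
      Finset.card_eq_sum_card_fiberwise (f := κ) (t := C)
        fun v _ => Finset.mem_image_of_mem _ (Finset.mem_univ v), Finset.sum_const_nat hm]
  have hμ : (uniformConjugate H : Measure (Subgroup Γ)).real E =
      (C.filter (· ∈ E)).card / C.card := by
    have h1 : (uniformConjugate H : Measure (Subgroup Γ)) = ProbabilityTheory.uniformOn ↑C := by
      rw [← hC]; rfl
    rw [h1, measureReal_def, ← ProbabilityTheory.uniformOn_inter_self C.finite_toSet]
    have h2 : (C : Set (Subgroup Γ)) ∩ E = (C.filter (· ∈ E) : Finset _) := by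
      ext K; simp
    rw [h2, ProbabilityTheory.uniformOn_apply_finset,
      Finset.inter_eq_right.2 (Finset.filter_subset _ _), ENNReal.toReal_div]
    simp
  have hC0 : (C.card : ℝ) ≠ 0 := by
    have : C.Nonempty := ⟨_, Finset.mem_image_of_mem κ (Finset.mem_univ ((1 : Γ) : Γ ⧸ H))⟩
    exact_mod_cast this.card_pos.ne'
  change _ = (({v : Γ ⧸ H | κ v ∈ E}.ncard : ℕ) : ℝ)
  rw [hμ, hE, hV]
  push_cast
  field_simp

/-- In a Farber sequence, almost every point is moved by every given nontrivial element. -/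
theorem IsFarber.tendsto_ncard_fixed {H : ℕ → Subgroup Γ} [∀ n, (H n).FiniteIndex]
    (hH : IsFarber H) {F : Set Γ} (hF : F.Finite) (h1 : (1 : Γ) ∉ F) :
    Tendsto (fun n => ({v : Γ ⧸ H n | ∃ g ∈ F, g • v = v}.ncard : ℝ) / (H n).index)
      atTop (𝓝 0) := by
  let E := {K : Subgroup Γ | ∃ g ∈ F, g ∈ K}
  have hE : IsClopen E := isClopen_setOf_exists_mem hF
  have key := ProbabilityMeasure.tendsto_iff_forall_integral_tendsto.1 hH
    (BoundedContinuousFunction.indicator E hE)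
  have hind : ∀ μ : ProbabilityMeasure (Subgroup Γ),
      ∫ K, BoundedContinuousFunction.indicator E hE K ∂(μ : Measure (Subgroup Γ)) =
        (μ : Measure (Subgroup Γ)).real E := fun μ =>
    integral_indicator_one hE.isOpen.measurableSet
  simp only [hind] at key
  have hbot : (uniformConjugate (⊥ : Subgroup Γ) : Measure (Subgroup Γ)).real E = 0 := by
    classical
    have h2 : (uniformConjugate (⊥ : Subgroup Γ) : Measure (Subgroup Γ)) =
        ProbabilityTheory.uniformOn {⊥} := by
      rw [← conjugates_bot]; rfl
    have h3 : (⊥ : Subgroup Γ) ∉ E := by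
      rintro ⟨g, hg, hg1⟩
      rw [Subgroup.mem_bot] at hg1
      exact h1 (hg1 ▸ hg)
    rw [h2, measureReal_def, ProbabilityTheory.uniformOn_singleton, if_neg h3]
    simp
  rw [hbot] at key
  refine key.congr fun n => ?_
  rw [eq_div_iff (by exact_mod_cast Subgroup.FiniteIndex.index_ne_zero),
    uniformConjugate_real_mul_index]
  rfl

theorem IsFarber.eventually_exists_not_fixed {H : ℕ → Subgroup Γ} [∀ n, (H n).FiniteIndex]
    (hH : IsFarber H) {F : Set Γ} (hF : F.Finite) (h1 : (1 : Γ) ∉ F) :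
    ∀ᶠ n in atTop, ∃ v : Γ ⧸ H n, ∀ g ∈ F, g • v ≠ v := by
  filter_upwards [(hH.tendsto_ncard_fixed hF h1).eventually_lt_const one_pos] with n hn
  by_contra! h
  have h2 : {v : Γ ⧸ H n | ∃ g ∈ F, g • v = v} = Set.univ := Set.eq_univ_of_forall h
  rw [h2, Set.ncard_univ, ← Subgroup.index, div_self] at hn
  · exact lt_irrefl _ hn
  · exact_mod_cast Subgroup.FiniteIndex.index_ne_zero

/-- The indices of a Farber sequence tend to infinity, unless `Γ` is finite. -/
theorem IsFarber.eventually_eq_bot_or_le_index {H : ℕ → Subgroup Γ} [∀ n, (H n).FiniteIndex]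
    (hH : IsFarber H) (k : ℕ) : ∀ᶠ n in atTop, H n = ⊥ ∨ k ≤ (H n).index := by
  rcases finite_or_infinite Γ with hΓ | hΓ
  -- For finite `Γ`, some coset is eventually fixed by no nontrivial element; its stabilizer is a
  -- conjugate of `H n`.
  · filter_upwards [hH.eventually_exists_not_fixed (Set.toFinite {g : Γ | g ≠ 1}) (by simp)]
      with n ⟨v, hv⟩
    left
    rw [eq_bot_iff]
    intro h hh
    obtain ⟨g, rfl⟩ := QuotientGroup.mk_surjective v
    by_contra hne
    refine hv (g * h * g⁻¹) (by simpa using hne) ?_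
    change ((g * h * g⁻¹ * g : Γ) : Γ ⧸ H n) = _
    rw [QuotientGroup.eq]
    simpa using hh
  · let f := Infinite.natEmbedding Γ
    -- A point fixed by none of these quotients is moved to `k` distinct points by `k` distinct
    -- elements.
    let F : Set Γ := (fun q : Fin k × Fin k => (f q.1)⁻¹ * f q.2) '' {q | q.1 ≠ q.2}
    have hF1 : (1 : Γ) ∉ F := by
      rintro ⟨q, hq, h⟩
      exact hq (Fin.ext (f.injective (inv_mul_eq_one.1 h)))
    filter_upwards [hH.eventually_exists_not_fixed (F := F) (Set.toFinite _) hF1] with n ⟨v, hv⟩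
    right
    by_contra! hlt
    have hinj : Function.Injective fun i : Fin k => f i • v := by
      intro i j hij
      by_contra hne
      refine hv _ ⟨(i, j), hne, rfl⟩ ?_
      simp only at hij ⊢
      rw [mul_smul, ← hij, inv_smul_smul]
    have := Nat.card_le_card_of_injective _ hinj
    rw [Nat.card_fin] at this
    exact absurd this hlt.not_ge

/-! ### Schreier graphs and the torsion bound for one subgroup. -/

theorem exists_walk_length_le {V : Type*} {G : SimpleGraph V} {x y : V} {d : ℕ}
    (h : G.edist x y ≤ d) : ∃ q : G.Walk x y, q.length ≤ d := by
  obtain ⟨q, hq⟩ := SimpleGraph.exists_walk_of_edist_ne_top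
    (ne_top_of_le_ne_top (ENat.natCast_ne_top d) h)
  exact ⟨q, by exact_mod_cast hq.trans_le h⟩

theorem edist_le_of_bilipDist_le {V : Type*} {G G' : SimpleGraph V} {d : ℕ∞}
    (h : bilipDist G G' ≤ d) {x y : V} : (G.Adj x y → G'.edist x y ≤ d) ∧
      (G'.Adj x y → G.edist x y ≤ d) := by
  simp only [bilipDist, max_le_iff, iSup_le_iff] at h
  exact ⟨h.1 x y, h.2 x y⟩

/-- Inversion, from right cosets to left cosets. -/
def rightCosetsEquiv (H : Subgroup Γ) : RightCosets H ≃ Γ ⧸ H :=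
  QuotientGroup.quotientRightRelEquivQuotientLeftRel H

theorem rightCosetsEquiv_mk (H : Subgroup Γ) (g : Γ) :
    rightCosetsEquiv H (Quotient.mk _ g) = ((g⁻¹ : Γ) : Γ ⧸ H) := rfl

theorem exists_smul_of_schreierGraph_adj {H : Subgroup Γ} {S : Finset Γ} {x y : RightCosets H}
    (h : (schreierGraph H S).Adj x y) :
    ∃ g ∈ unitBall S, g • rightCosetsEquiv H x = rightCosetsEquiv H y := by
  rw [schreierGraph, SimpleGraph.fromRel_adj] at h
  obtain ⟨-, ⟨g, s, hs, rfl, rfl⟩ | ⟨g, s, hs, rfl, rfl⟩⟩ := h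
  · refine ⟨s⁻¹, Or.inr (Or.inr (by simpa using hs)), ?_⟩
    rw [rightCosetsEquiv_mk, rightCosetsEquiv_mk, mul_inv_rev]
    rfl
  · refine ⟨s, mem_unitBall hs, ?_⟩
    rw [rightCosetsEquiv_mk, rightCosetsEquiv_mk, mul_inv_rev]
    change ((s * (s⁻¹ * g⁻¹) : Γ) : Γ ⧸ H) = _
    rw [mul_inv_cancel_left]

theorem exists_smul_of_schreierGraph_walk {H : Subgroup Γ} {S : Finset Γ} {x y : RightCosets H}
    (q : (schreierGraph H S).Walk x y) :
    ∃ g ∈ unitBall S ^ q.length, g • rightCosetsEquiv H x = rightCosetsEquiv H y := by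
  induction q with
  | nil => exact ⟨1, by simp, by simp⟩
  | cons h q ih =>
    obtain ⟨s, hs, hsx⟩ := exists_smul_of_schreierGraph_adj h
    obtain ⟨g, hg, hgy⟩ := ih
    refine ⟨g * s, ?_, by rw [mul_smul, hsx, hgy]⟩
    rw [SimpleGraph.Walk.length_cons, pow_succ]
    exact Set.mul_mem_mul hg hs

theorem schreierGraph_adj_smul {H : Subgroup Γ} {S : Finset Γ} {s : Γ} (hs : s ∈ S) (v : Γ ⧸ H)
    (hv : s • v ≠ v) :
    (schreierGraph H S).Adj ((rightCosetsEquiv H).symm v) ((rightCosetsEquiv H).symm (s • v)) := by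
  rw [schreierGraph, SimpleGraph.fromRel_adj]
  refine ⟨(rightCosetsEquiv H).symm.injective.ne hv.symm, Or.inr ?_⟩
  obtain ⟨g, rfl⟩ := QuotientGroup.mk_surjective v
  refine ⟨g⁻¹ * s⁻¹, s, hs, ?_, ?_⟩
  · rw [Equiv.symm_apply_eq, rightCosetsEquiv_mk, mul_inv_rev, inv_inv, inv_inv]
    rfl
  · rw [Equiv.symm_apply_eq, rightCosetsEquiv_mk, inv_mul_cancel_right, inv_inv]

theorem preconnected_of_walks {V : Type*} [MulAction Γ V] [MulAction.IsPretransitive Γ V]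
    {S : Finset Γ} (hS : Subgroup.closure (S : Set Γ) = ⊤) {G : SimpleGraph V}
    (h : ∀ s ∈ S, ∀ v, G.Reachable v (s • v)) : G.Preconnected := by
  have key : ∀ g : Γ, ∀ v, G.Reachable v (g • v) := by
    intro g
    have hg : g ∈ Subgroup.closure (S : Set Γ) := hS ▸ Subgroup.mem_top g
    induction hg using Subgroup.closure_induction with
    | mem s hs => exact h s hs
    | one => intro v; rw [one_smul]
    | mul x y _ _ hx hy => intro v; rw [mul_smul]; exact (hy v).trans (hx _)
    | inv x _ hx =>
      intro v
      have h1 := hx (x⁻¹ • v)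
      rw [smul_inv_smul] at h1
      exact h1.symm
  intro v w
  obtain ⟨g, rfl⟩ := MulAction.exists_smul_eq Γ v w
  exact key g v

/-- The points of `Γ ⧸ H` at which the injectivity radius is less than `n`. -/
def thinPart (S : Finset Γ) (H : Subgroup Γ) (n : ℕ) : Set (Γ ⧸ H) :=
  {v | ∃ g ∈ unitBall S ^ n \ {1}, g • v = v}

theorem IsFarber.tendsto_ncard_thinPart {H : ℕ → Subgroup Γ} [∀ n, (H n).FiniteIndex]
    (hH : IsFarber H) (S : Finset Γ) (r : ℕ) :
    Tendsto (fun n => ((thinPart S (H n) r).ncard : ℝ) / (H n).index) atTop (𝓝 0) :=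
  hH.tendsto_ncard_fixed (unitBall_pow_finite r).sdiff fun h => h.2 rfl

/-- The homology torsion of a finite index subgroup, in terms of a rewiring of its Schreier
graph and the number of points where the injectivity radius is small. -/
theorem exists_trs_le_pow [Group.IsFinitelyPresented Γ] (S : Finset Γ)
    (hS : Subgroup.closure (S : Set Γ) = ⊤) :
    ∃ C : ℕ, 0 < C ∧ ∀ (H : Subgroup Γ) [H.FiniteIndex] (G : SimpleGraph (RightCosets H)) (d : ℕ),
      0 < d → bilipDist (schreierGraph H S) G ≤ d →
      Finite (CommGroup.torsion (Abelianization H)) ∧ ∃ m : ℕ, trs H ≤ (C * d) ^ m ∧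
        m + H.index ≤ G.edgeSet.ncard + 1 + (thinPart S H (d * d + 1)).ncard * S.card := by
  obtain ⟨N, φ, hφ, R, hRfin, hR⟩ := Group.IsFinitelyPresented.out (G := Γ)
  obtain ⟨k, hk⟩ : ∃ k, ∀ f ∈ R, f.norm ≤ k := by
    obtain ⟨k, hk⟩ := (hRfin.image FreeGroup.norm).bddAbove
    exact ⟨k, fun f hf => hk ⟨f, hf, rfl⟩⟩
  obtain ⟨l, hl⟩ : ∃ l, ∀ x, φ (.of x) ∈ unitBall S ^ l := by
    choose l hl using fun x => exists_mem_unitBall_pow hS (φ (.of x))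
    exact ⟨Finset.univ.sup l, fun x => unitBall_pow_mono (Finset.le_sup (Finset.mem_univ x)) (hl x)⟩
  -- `k` bounds the relator lengths and `l` the `S`-lengths of the generators of the presentation,
  -- which need not be related to `S`; the added ones ensure positivity.
  refine ⟨(k + 1) * (l + 1), by positivity, ?_⟩
  intro H _ G₀ d hd hG₀
  let e := rightCosetsEquiv H
  let G : SimpleGraph (Γ ⧸ H) := G₀.map e.toEmbedding
  have : Finite (Γ ⧸ H) := Subgroup.finite_quotient_of_finiteIndex
  have hwalk : ∀ {x y}, G₀.edist x y ≤ d → ∃ q : G.Walk (e x) (e y), q.length ≤ d := by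
    intro x y h
    obtain ⟨q, hq⟩ := exists_walk_length_le h
    let i : G₀ →g G := ⟨e, fun h => ⟨e.injective.ne h.ne, _, _, h, rfl, rfl⟩⟩
    exact ⟨q.map i, (SimpleGraph.Walk.length_map i q).trans_le hq⟩
  have hSG : ∀ s ∈ S, ∀ v, ∃ q : G.Walk v (s • v), q.length ≤ d := by
    intro s hs v
    by_cases hv : s • v = v
    · exact ⟨SimpleGraph.Walk.nil.copy rfl hv.symm, by simp⟩
    · obtain ⟨q, hq⟩ :=
        hwalk ((edist_le_of_bilipDist_le hG₀).1 (schreierGraph_adj_smul hs v hv))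
      exact ⟨q.copy (e.apply_symm_apply v) (e.apply_symm_apply _), by simpa using hq⟩
  have hGS : ∀ x y, G.Adj x y → ∃ g ∈ unitBall S ^ d, g • x = y := by
    rintro _ _ ⟨-, x, y, h, rfl, rfl⟩
    obtain ⟨q, hq⟩ := exists_walk_length_le ((edist_le_of_bilipDist_le hG₀).2 h)
    obtain ⟨g, hg, hgx⟩ := exists_smul_of_schreierGraph_walk q
    exact ⟨g, unitBall_pow_mono hq hg, hgx⟩
  have hG : G.Preconnected := preconnected_of_walks hS fun s hs v =>
    let ⟨q, _⟩ := hSG s hs v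
    ⟨q⟩
  obtain ⟨c, hc, hc1⟩ := exists_cocycle H
  obtain ⟨b, T, hb, hcard, hT⟩ := exists_coboundary_small hc ((1 : Γ) : Γ ⧸ H) S G hG d hd hGS hSG
    (thinPart S H (d * d + 1)) (by
      intro v hv g hg hgv
      by_contra h
      exact hv ⟨g, ⟨hg, h⟩, hgv⟩)
  have hc' := hc.add_coboundary b
  have hedge : G.edgeSet.ncard = G₀.edgeSet.ncard :=
    (Nat.card_congr (SimpleGraph.Iso.map e G₀).mapEdgeSet).symm
  obtain ⟨hfin, htrs⟩ := trs_le_pow φ hφ R hR (k + 1) (fun f hf => (hk f hf).trans k.le_succ) H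
    (Subtype.val : T → Additive (Abelianization H)) _ hc' (fun h => by
      have h1 : (h : Γ) • ((1 : Γ) : Γ ⧸ H) = (1 : Γ) := by
        change (((h : Γ) * 1 : Γ) : Γ ⧸ H) = _
        rw [QuotientGroup.eq]
        simp
      simp only [h1, hb, hc1, add_zero, sub_zero]) ((l + 1) * d)
    (fun x v => hc'.mem_l1Ball_of_mem_unitBall_pow hT (l + 1) _
      (unitBall_pow_mono l.le_succ (hl x)) v)
    (Nat.mul_pos k.succ_pos (Nat.mul_pos l.succ_pos hd))
  refine ⟨hfin, T.card, ?_, ?_⟩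
  · rwa [Fintype.card_coe, ← mul_assoc] at htrs
  · rwa [hedge] at hcard

theorem trs_bot : trs (⊥ : Subgroup Γ) = 1 := by
  have : Subsingleton (Abelianization (⊥ : Subgroup Γ)) := QuotientGroup.mk_surjective.subsingleton
  exact Nat.card_unique

end TorsionGrowth

end

/-! ### The limit. -/

theorem mainTheorem7 {Γ : Type*} [Group Γ] [Group.IsFinitelyPresented Γ]
    (S : Finset Γ) (hS : Subgroup.closure (S : Set Γ) = ⊤)
    (Γseq : ℕ → Subgroup Γ) [∀ n, (Γseq n).FiniteIndex]
    (hFarber : TorsionGrowth.IsFarber Γseq)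
    (hdist : TorsionGrowth.HasSubexponentialDistortion
      fun n => TorsionGrowth.schreierGraph (Γseq n) S) :
    (∀ n, Finite (CommGroup.torsion (Abelianization (Γseq n)))) ∧
    Tendsto
      (fun n => Real.log (TorsionGrowth.trs (Γseq n)) / ((Γseq n).index : ℝ))
      atTop (𝓝 0) := by
  obtain ⟨C, hC, hbound⟩ := TorsionGrowth.exists_trs_le_pow S hS
  obtain ⟨d, ε, G, hd, hε, hεd, hG⟩ := hdist
  refine ⟨fun n => (hbound (Γseq n) (G 0 n) (d 0) (hd 0) ((hG 0).1 n)).1, ?_⟩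
  -- The factor `C` is harmless because `ε r` itself tends to zero.
  have hlim : Tendsto (fun r => ε r * Real.log (C * d r)) atTop (𝓝 0) := by
    have h := (hε.mul_const (Real.log C)).add hεd
    rw [zero_mul, zero_add] at h
    refine h.congr fun r => ?_
    rw [Real.log_mul (by exact_mod_cast hC.ne') (by exact_mod_cast (hd r).ne')]
    ring
  rw [Metric.tendsto_nhds]
  intro δ hδ
  -- One `r` is now fixed. The budget is `δ / 2` for the excess edges and `δ / 4` each for the extra
  -- edge left by a spanning tree and for the thin part; the second needs index at least `k`.
  obtain ⟨r, hr⟩ := (hlim.eventually_lt_const (half_pos hδ)).exists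
  have hL : 0 ≤ Real.log (C * d r) := Real.log_nonneg (by
    exact_mod_cast Nat.mul_pos hC (hd r))
  set L := Real.log (C * d r) with hLdef
  obtain ⟨k, hk⟩ := exists_nat_gt (4 * L / δ)
  have hk0 : (0 : ℝ) < k := lt_of_le_of_lt (by positivity) hk
  have hbad := ((hFarber.tendsto_ncard_thinPart S (d r * d r + 1)).const_mul (S.card * L)).eventually_lt_const
    (show (S.card * L) * 0 < δ / 4 by linarith)
  filter_upwards [eventually_lt_of_limsup_lt (hG r).2, hbad,
    hFarber.eventually_eq_bot_or_le_index k] with n hdens hbad hn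
  rw [EReal.coe_lt_coe_iff] at hdens
  rw [Real.dist_0_eq_abs, abs_of_nonneg (by positivity)]
  -- The index stays bounded only for finite `Γ`, where the subgroups are eventually trivial and
  -- have no torsion.
  rcases hn with hn | hn
  · rw [hn, TorsionGrowth.trs_bot]
    simpa using hδ
  obtain ⟨m, htrs, hm⟩ := (hbound (Γseq n) (G r n) (d r) (hd r) ((hG r).1 n)).2
  set β := (TorsionGrowth.thinPart S (Γseq n) (d r * d r + 1)).ncard
  have hV : Nat.card (TorsionGrowth.RightCosets (Γseq n)) = (Γseq n).index :=
    Nat.card_congr (TorsionGrowth.rightCosetsEquiv (Γseq n))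
  have hi : (k : ℝ) ≤ (Γseq n).index := by exact_mod_cast hn
  rw [TorsionGrowth.edgeDensity, hV] at hdens
  set i : ℝ := ((Γseq n).index : ℝ)
  have hi0 : 0 < i := hk0.trans_le hi
  have hlog : Real.log (TorsionGrowth.trs (Γseq n)) ≤ m * L := by
    rcases Nat.eq_zero_or_pos (TorsionGrowth.trs (Γseq n)) with h0 | h0
    · rw [h0, Nat.cast_zero, Real.log_zero]
      positivity
    · refine (Real.log_le_log (by exact_mod_cast h0) (Nat.cast_le.2 htrs)).trans_eq ?_
      rw [Nat.cast_pow, Real.log_pow, Nat.cast_mul]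
  have hm' : (m : ℝ) + i ≤ (G r n).edgeSet.ncard + 1 + β * S.card := by
    have h : ((m + (Γseq n).index : ℕ) : ℝ) ≤ _ := Nat.cast_le.2 hm
    push_cast at h
    exact h
  rw [div_lt_iff₀ hi0] at hdens
  rw [div_lt_iff₀ hi0]
  have h1 : (m : ℝ) ≤ ε r * i + 1 + β * S.card := by linarith
  have h2 : L < δ / 4 * i := by
    rw [div_lt_iff₀ hδ] at hk
    nlinarith
  have h3 : S.card * L * β < δ / 4 * i := by
    rwa [← mul_div_assoc, div_lt_iff₀ hi0] at hbad
  calc Real.log (TorsionGrowth.trs (Γseq n)) ≤ m * L := hlog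
    _ ≤ (ε r * i + 1 + β * S.card) * L := mul_le_mul_of_nonneg_right h1 hL
    _ = ε r * L * i + L + S.card * L * β := by ring
    _ < δ * i := by
      have := mul_lt_mul_of_pos_right hr hi0
      linarith
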